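/- Let $n\in\{7,8\}$. Consider the Heilbronn triangle problem with $n$ points, $$\max_{(x,y)\in[0,1]^n\times[0,1]^n}\ \min_{1\le i<j<k\le n}\ \tfrac12\bigl|x_i(y_j-y_k)-x_j(y_i-y_k)+x_k(y_i-y_j)\bigr|,$$ and write $w_{ij}=x_iy_j$ for $1\le i,j\le n$. There exists an optimal solution $(x,y)$ of this problem such that (i) $y_1=y_2=0$, and (ii) $w_{i1}=w_{i2}=0$ for all $i=1,\dots,n$. -/

import Mathlib

/-!
The Heilbronn triangle problem for `n` labelled points `(x i, y i)` in the unit square.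
The indices `1, …, n` are represented by the elements `0, …, n - 1` of `Fin n`.
-/

namespace Heilbronn

noncomputable section

/-- The area of the triangle with corners `(x i, y i)`, `(x j, y j)` and `(x k, y k)`. -/
def triangleArea {n : ℕ} (x y : Fin n → ℝ) (i j k : Fin n) : ℝ :=
  1 / 2 * |x i * (y j - y k) - x j * (y i - y k) + x k * (y i - y j)|

/-- The triples of indices `i < j < k`. -/
abbrev Triple (n : ℕ) : Type :=
  {t : Fin n × Fin n × Fin n // t.1 < t.2.1 ∧ t.2.1 < t.2.2}

/-- The smallest area of a triangle formed by three of the points. For `n ≥ 3` this is the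
minimum of a finite nonempty family of reals. -/
def minArea {n : ℕ} (x y : Fin n → ℝ) : ℝ :=
  ⨅ t : Triple n, triangleArea x y t.1.1 t.1.2.1 t.1.2.2

/-- The feasible set `[0,1]^n × [0,1]^n`. -/
def feasibleSet (n : ℕ) : Set ((Fin n → ℝ) × (Fin n → ℝ)) :=
  {p | (∀ i, p.1 i ∈ Set.Icc (0 : ℝ) 1) ∧ ∀ i, p.2 i ∈ Set.Icc (0 : ℝ) 1}

/-- `(x, y)` is an optimal solution of the Heilbronn triangle problem with `n` points: it is
feasible and maximizes the smallest triangle area over the feasible set. -/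
def IsOptimal {n : ℕ} (x y : Fin n → ℝ) : Prop :=
  (x, y) ∈ feasibleSet n ∧
    IsMaxOn (fun p : (Fin n → ℝ) × (Fin n → ℝ) => minArea p.1 p.2) (feasibleSet n) (x, y)

/-- The bilinear variables `w i j = x i * y j`. -/
def w {n : ℕ} (x y : Fin n → ℝ) (i j : Fin n) : ℝ :=
  x i * y j

end

end Heilbronn

namespace Heilbronn

variable {n : ℕ} {x y x' y' : Fin n → ℝ}

lemma triple_nonempty (hn : 3 ≤ n) : Nonempty (Triple n) :=
  ⟨⟨(⟨0, by omega⟩, ⟨1, by omega⟩, ⟨2, by omega⟩), by simp [Fin.lt_def]⟩⟩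

lemma triangleArea_swap_left (x y : Fin n → ℝ) (i j k : Fin n) :
    triangleArea x y j i k = triangleArea x y i j k := by
  unfold triangleArea
  rw [← abs_neg]; congr 2; ring

lemma triangleArea_swap_right (x y : Fin n → ℝ) (i j k : Fin n) :
    triangleArea x y i k j = triangleArea x y i j k := by
  unfold triangleArea
  rw [← abs_neg]; congr 2; ring

lemma minArea_le (x y : Fin n → ℝ) {i j k : Fin n} (hij : i < j) (hjk : j < k) :
    minArea x y ≤ triangleArea x y i j k :=
  ciInf_le (f := fun t : Triple n => triangleArea x y t.1.1 t.1.2.1 t.1.2.2)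
    (Set.finite_range _).bddBelow ⟨(i, j, k), hij, hjk⟩

lemma minArea_le_of_ne (x y : Fin n → ℝ) {i j k : Fin n} (hij : i ≠ j) (hjk : j ≠ k)
    (hik : i ≠ k) : minArea x y ≤ triangleArea x y i j k := by
  rcases hij.lt_or_gt with h | h <;> rcases hjk.lt_or_gt with h' | h' <;>
    rcases hik.lt_or_gt with h'' | h''
  · exact minArea_le x y h h'
  · exact absurd (h.trans h') h''.asymm
  · rw [← triangleArea_swap_right]; exact minArea_le x y h'' h'
  · rw [← triangleArea_swap_right, ← triangleArea_swap_left]; exact minArea_le x y h'' h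
  · rw [← triangleArea_swap_left]; exact minArea_le x y h h''
  · rw [← triangleArea_swap_left, ← triangleArea_swap_right]; exact minArea_le x y h' h''
  · exact absurd (h'.trans h) h''.asymm
  · rw [← triangleArea_swap_right, ← triangleArea_swap_left, ← triangleArea_swap_right]
    exact minArea_le x y h' h

lemma minArea_le_minArea_comp (hn : 3 ≤ n) (x y : Fin n → ℝ) {σ : Fin n → Fin n}
    (hσ : Function.Injective σ) : minArea x y ≤ minArea (x ∘ σ) (y ∘ σ) := by
  have := triple_nonempty hn
  refine le_ciInf fun t => ?_
  exact minArea_le_of_ne x y (hσ.ne t.2.1.ne) (hσ.ne t.2.2.ne) (hσ.ne (t.2.1.trans t.2.2).ne)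

lemma minArea_swap (x y : Fin n → ℝ) : minArea y x = minArea x y := by
  unfold minArea triangleArea
  congr 1; funext t
  rw [← abs_neg]; congr 2; ring

lemma minArea_one_sub (x y : Fin n → ℝ) : minArea (fun i => 1 - x i) y = minArea x y := by
  unfold minArea triangleArea
  congr 1; funext t
  rw [← abs_neg]; congr 2; ring

/-- A horizontal shear, followed by a translation and a scaling of the first coordinate. -/
lemma minArea_shear (x y : Fin n → ℝ) (t c : ℝ) {s : ℝ} (hs : 0 ≤ s) :
    minArea (fun i => s * (x i + t * y i - c)) y = s * minArea x y := by
  unfold minArea triangleArea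
  rw [Real.mul_iInf_of_nonneg hs]
  congr 1; funext p
  rw [mul_left_comm, ← abs_of_nonneg hs, ← abs_mul, abs_of_nonneg hs]
  congr 2; ring

lemma continuous_minArea (hn : 3 ≤ n) :
    Continuous fun p : (Fin n → ℝ) × (Fin n → ℝ) => minArea p.1 p.2 := by
  have := triple_nonempty hn
  unfold minArea
  simp_rw [← Finset.inf'_univ_eq_ciInf]
  refine Continuous.finset_inf'_apply _ fun t _ => ?_
  unfold triangleArea
  fun_prop

lemma isCompact_feasibleSet (n : ℕ) : IsCompact (feasibleSet n) := by
  have h : feasibleSet n = (Set.univ.pi fun _ : Fin n => Set.Icc (0 : ℝ) 1) ×ˢ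
      (Set.univ.pi fun _ : Fin n => Set.Icc (0 : ℝ) 1) := by
    ext p
    simp only [feasibleSet, Set.mem_ofPred_eq, Set.mem_prod, Set.mem_univ_pi]
  rw [h]
  exact (isCompact_univ_pi fun _ => isCompact_Icc).prod (isCompact_univ_pi fun _ => isCompact_Icc)

lemma IsOptimal.of_le (h : IsOptimal x y) (hf : (x', y') ∈ feasibleSet n)
    (hle : minArea x y ≤ minArea x' y') : IsOptimal x' y' :=
  ⟨hf, fun p hp => (show minArea p.1 p.2 ≤ minArea x y from h.2 hp).trans hle⟩

lemma IsOptimal.le (h : IsOptimal x y) (hf : (x', y') ∈ feasibleSet n) :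
    minArea x' y' ≤ minArea x y :=
  isMaxOn_iff.1 h.2 (x', y') hf

lemma IsOptimal.swap (h : IsOptimal x y) : IsOptimal y x :=
  h.of_le ⟨h.1.2, h.1.1⟩ (minArea_swap x y).ge

lemma IsOptimal.one_sub (h : IsOptimal x y) : IsOptimal (fun i => 1 - x i) y :=
  h.of_le ⟨fun i => ⟨by linarith [(h.1.1 i).2], by linarith [(h.1.1 i).1]⟩, h.1.2⟩
    (minArea_one_sub x y).ge

lemma IsOptimal.comp (hn : 3 ≤ n) (h : IsOptimal x y) {σ : Fin n → Fin n}
    (hσ : Function.Injective σ) : IsOptimal (x ∘ σ) (y ∘ σ) :=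
  h.of_le ⟨fun i => h.1.1 (σ i), fun i => h.1.2 (σ i)⟩ (minArea_le_minArea_comp hn x y hσ)

/-- Points on a parabola are in general position, so the optimal value is positive. -/
lemma IsOptimal.minArea_pos (hn : 3 ≤ n) (h : IsOptimal x y) : 0 < minArea x y := by
  have := triple_nonempty hn
  have hn0 : (0 : ℝ) < n := by exact_mod_cast (by omega : 0 < n)
  let u : Fin n → ℝ := fun i => (i : ℕ) / (n : ℝ)
  have hu : ∀ {i j : Fin n}, i < j → u i < u j := fun {i j} hij =>
    div_lt_div_of_pos_right (by exact_mod_cast hij) hn0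
  have hu01 : ∀ i, u i ∈ Set.Icc (0 : ℝ) 1 := fun i =>
    ⟨by positivity, (div_le_one hn0).2 (by exact_mod_cast i.2.le)⟩
  refine lt_of_lt_of_le ?_ (h.le (x' := u) (y' := fun i => u i ^ 2)
    ⟨hu01, fun i => ⟨sq_nonneg _, pow_le_one₀ (hu01 i).1 (hu01 i).2⟩⟩)
  obtain ⟨⟨⟨i, j, k⟩, hij, hjk⟩, ht⟩ := exists_eq_ciInf_of_finite
    (f := fun t : Triple n => triangleArea u (fun i => u i ^ 2) t.1.1 t.1.2.1 t.1.2.2)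
  unfold minArea
  rw [← ht]
  dsimp only at hij hjk ⊢
  have h1 := sub_pos.2 (hu hij)
  have h2 := sub_pos.2 (hu hjk)
  have h3 := sub_pos.2 (hu (hij.trans hjk))
  have hdet : u i * (u j ^ 2 - u k ^ 2) - u j * (u i ^ 2 - u k ^ 2) + u k * (u i ^ 2 - u j ^ 2)
      = (u j - u i) * (u k - u j) * (u k - u i) := by ring
  unfold triangleArea
  rw [hdet]
  positivity

/-- Shearing an optimal configuration cannot shrink its horizontal extent below `1`. -/
lemma IsOptimal.one_le_of_shear (hn : 3 ≤ n) (h : IsOptimal x y) {t c d : ℝ}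
    (hc : ∀ i, c ≤ x i + t * y i) (hd : ∀ i, x i + t * y i ≤ d) : 1 ≤ d - c := by
  have hM := h.minArea_pos hn
  by_contra! hlt
  let r := max (d - c) (1 / 2)
  have hr0 : 0 < r := lt_max_of_lt_right (by norm_num)
  have hr1 : r < 1 := max_lt hlt (by norm_num)
  have hle := h.le (x' := fun i => r⁻¹ * (x i + t * y i - c)) (y' := y)
    ⟨fun i => ⟨mul_nonneg (by positivity) (sub_nonneg.2 (hc i)), by
      rw [inv_mul_le_one₀ hr0]
      exact le_max_of_le_left (by linarith [hd i])⟩, h.1.2⟩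
  rw [minArea_shear x y t c (by positivity)] at hle
  have : 1 < r⁻¹ := (one_lt_inv₀ hr0).2 hr1
  nlinarith

lemma IsOptimal.exists_eq_zero (hn : 3 ≤ n) (h : IsOptimal x y) : ∃ i, x i = 0 := by
  have : Nonempty (Fin n) := ⟨⟨0, by omega⟩⟩
  obtain ⟨a, ha⟩ := Finite.exists_min x
  have := h.one_le_of_shear hn (t := 0) (c := x a) (d := 1) (by simpa using ha)
    (by simpa using fun i => (h.1.1 i).2)
  exact ⟨a, le_antisymm (by linarith) (h.1.1 a).1⟩

lemma IsOptimal.exists_eq_one (hn : 3 ≤ n) (h : IsOptimal x y) : ∃ i, x i = 1 := by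
  obtain ⟨i, hi⟩ := h.one_sub.exists_eq_zero hn
  exact ⟨i, by linarith⟩

lemma minArea_nonpos_of_const (hn : 3 ≤ n) {c : ℝ} (hy : ∀ i, y i = c) : minArea x y ≤ 0 := by
  obtain ⟨⟨⟨i, j, k⟩, hij, hjk⟩⟩ := triple_nonempty hn
  refine (minArea_le x y hij hjk).trans ?_
  simp [triangleArea, hy]

lemma exists_isOptimal (hn : 3 ≤ n) : ∃ x y : Fin n → ℝ, IsOptimal x y := by
  obtain ⟨p, hp, hmax⟩ := (isCompact_feasibleSet n).exists_isMaxOn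
    ⟨(0, 0), fun _ => by simp, fun _ => by simp⟩ (continuous_minArea hn).continuousOn
  exact ⟨p.1, p.2, hp, hmax⟩

/-- Some optimal configuration maximizes `∑ i, x i ^ 2` among all optimal configurations. -/
lemma exists_isOptimal_max_sum_sq (hn : 3 ≤ n) :
    ∃ x y : Fin n → ℝ, IsOptimal x y ∧
      ∀ x' y' : Fin n → ℝ, IsOptimal x' y' → ∑ i, x' i ^ 2 ≤ ∑ i, x i ^ 2 := by
  obtain ⟨x₀, y₀, h₀⟩ := exists_isOptimal hn
  have hK : IsCompact (feasibleSet n ∩ {p | minArea x₀ y₀ ≤ minArea p.1 p.2}) :=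
    (isCompact_feasibleSet n).inter_right
      (isClosed_le continuous_const (continuous_minArea hn))
  obtain ⟨p, hp, hmax⟩ := hK.exists_isMaxOn ⟨(x₀, y₀), h₀.1, le_refl (minArea x₀ y₀)⟩
    (f := fun p => ∑ i, p.1 i ^ 2) (by fun_prop)
  refine ⟨p.1, p.2, h₀.of_le hp.1 hp.2, fun x' y' h' => ?_⟩
  exact hmax (a := (x', y')) ⟨h'.1, h'.le h₀.1⟩

/-- If only `a` lies on the left side and only `b` on the right side, they stay extreme under all
small shears. -/
lemma eventually_shear_mem {a b : Fin n} (ha : ∀ i, i ≠ a → x a < x i)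
    (hb : ∀ i, i ≠ b → x i < x b) (y : Fin n → ℝ) :
    ∀ᶠ t : ℝ in nhds 0, ∀ i, x a + t * y a ≤ x i + t * y i ∧ x i + t * y i ≤ x b + t * y b := by
  have key : ∀ i j, (i ≠ j → x i < x j) → ∀ᶠ t : ℝ in nhds 0, x i + t * y i ≤ x j + t * y j := by
    intro i j hij
    by_cases e : i = j
    · subst e; simp
    · have hc : ∀ k, Filter.Tendsto (fun t : ℝ => x k + t * y k) (nhds 0) (nhds (x k)) := by
        intro k
        have : Continuous fun t : ℝ => x k + t * y k := by fun_prop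
        simpa using this.tendsto 0
      exact ((hc i).eventually_lt (hc j) (hij e)).mono fun _ => le_of_lt
  refine Filter.eventually_all.2 fun i => ?_
  exact (key a i fun e => ha i e.symm).and (key i b fun e => hb i e)

/-- Some optimal configuration has two points on the left side or two points on the right side. -/
lemma exists_isOptimal_two_on_side (hn : 3 ≤ n) :
    ∃ x y : Fin n → ℝ, IsOptimal x y ∧
      ∃ i j, i ≠ j ∧ ((x i = 0 ∧ x j = 0) ∨ (x i = 1 ∧ x j = 1)) := by
  obtain ⟨x, y, h, hmax⟩ := exists_isOptimal_max_sum_sq hn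
  refine ⟨x, y, h, ?_⟩
  by_contra! hcon
  obtain ⟨a, ha⟩ := h.exists_eq_zero hn
  obtain ⟨b, hb⟩ := h.exists_eq_one hn
  have ha' : ∀ i, i ≠ a → x a < x i := fun i hi =>
    ha ▸ lt_of_le_of_ne (h.1.1 i).1 fun e => (hcon i a hi).1 e.symm ha
  have hb' : ∀ i, i ≠ b → x i < x b := fun i hi =>
    hb ▸ lt_of_le_of_ne (h.1.1 i).2 fun e => (hcon i b hi).2 e hb
  obtain ⟨ε, hε, hball⟩ := Metric.eventually_nhds_iff.1 (eventually_shear_mem ha' hb' y)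
  obtain ⟨t, ht0, htε⟩ := exists_between hε
  have hp := hball (y := t) (by simpa [abs_of_pos ht0] using htε)
  have hm := hball (y := -t) (by simpa [abs_of_pos ht0] using htε)
  have hp1 := h.one_le_of_shear hn (fun i => (hp i).1) fun i => (hp i).2
  have hm1 := h.one_le_of_shear hn (fun i => (hm i).1) fun i => (hm i).2
  have hopt : ∀ s : ℝ, s * (y b - y a) = 0 →
      (∀ i, x a + s * y a ≤ x i + s * y i ∧ x i + s * y i ≤ x b + s * y b) →
      ∑ i, (x i + s * (y i - y a)) ^ 2 ≤ ∑ i, x i ^ 2 := by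
    intro s hs hi
    have e : (fun i => 1 * (x i + s * y i - s * y a)) = fun i => x i + s * (y i - y a) := by
      funext i; ring
    refine hmax _ y (h.of_le ⟨fun i => ⟨?_, ?_⟩, h.1.2⟩ ?_)
    · linarith [(hi i).1]
    · linarith [(hi i).2]
    · rw [← e, minArea_shear x y s _ zero_le_one, one_mul]
  have h1 := hopt t (by linarith) hp
  have h2 := hopt (-t) (by linarith) hm
  have hsum : ∑ i, (x i + t * (y i - y a)) ^ 2 + ∑ i, (x i + -t * (y i - y a)) ^ 2
      = 2 * ∑ i, x i ^ 2 + 2 * ∑ i, (t * (y i - y a)) ^ 2 := by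
    simp only [Finset.mul_sum, ← Finset.sum_add_distrib]
    exact Finset.sum_congr rfl fun i _ => by ring
  have hzero : ∑ i, (t * (y i - y a)) ^ 2 = 0 :=
    le_antisymm (by linarith) (Finset.sum_nonneg fun _ _ => sq_nonneg _)
  rw [Finset.sum_eq_zero_iff_of_nonneg fun _ _ => sq_nonneg _] at hzero
  refine (h.minArea_pos hn).not_ge (minArea_nonpos_of_const hn (c := y a) fun i => ?_)
  have := hzero i (Finset.mem_univ i)
  simpa [ht0.ne', sub_eq_zero] using this

lemma exists_isOptimal_two_on_bottom (hn : 3 ≤ n) :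
    ∃ x y : Fin n → ℝ, IsOptimal x y ∧ ∃ i j, i ≠ j ∧ y i = 0 ∧ y j = 0 := by
  obtain ⟨x, y, h, i, j, hij, h0 | h1⟩ := exists_isOptimal_two_on_side hn
  · exact ⟨y, x, h.swap, i, j, hij, h0⟩
  · exact ⟨y, _, h.one_sub.swap, i, j, hij, by simp [h1.1], by simp [h1.2]⟩

lemma exists_perm_apply_eq {α : Type*} [DecidableEq α] {p q i j : α} (hpq : p ≠ q)
    (hij : i ≠ j) : ∃ σ : Equiv.Perm α, σ p = i ∧ σ q = j := by
  have hp : p ≠ Equiv.swap p i j := fun e => hij (by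
    simpa using congrArg (Equiv.swap p i) e)
  refine ⟨(Equiv.swap q (Equiv.swap p i j)).trans (Equiv.swap p i), ?_, ?_⟩
  · simp [Equiv.swap_apply_of_ne_of_ne hpq hp]
  · simp

end Heilbronn

open Heilbronn in
theorem mainTheorem11 (n : ℕ) (hn : n = 7 ∨ n = 8) :
    ∃ x y : Fin n → ℝ,
      Heilbronn.IsOptimal x y ∧
      (y ⟨0, by omega⟩ = 0 ∧ y ⟨1, by omega⟩ = 0) ∧
      ∀ i : Fin n,
        Heilbronn.w x y i ⟨0, by omega⟩ = 0 ∧ Heilbronn.w x y i ⟨1, by omega⟩ = 0 := by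
  have hn3 : 3 ≤ n := by omega
  obtain ⟨x, y, h, i, j, hij, hi, hj⟩ := exists_isOptimal_two_on_bottom hn3
  obtain ⟨σ, h0, h1⟩ := exists_perm_apply_eq
    (p := (⟨0, by omega⟩ : Fin n)) (q := ⟨1, by omega⟩) (by simp) hij
  refine ⟨x ∘ σ, y ∘ σ, h.comp hn3 σ.injective, ⟨?_, ?_⟩, fun k => ⟨?_, ?_⟩⟩ <;>
    simp [w, h0, h1, hi, hj]
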